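/- There is an absolute constant $C>0$ with the following property. Let $\alpha\in(0,1)$, $\kappa_1>0$, $\kappa_2\ge 0$, $T>0$, and let $u$ be a classical solution on $[0,1]\times[0,T]$ of the time-fractional advection-dispersion problem $$D_t^{\alpha}u=\kappa_1u_{xx}-\kappa_2u_x+S\ \text{ on }(0,1)\times(0,T],\qquad u(x,0)=g(x)\ (0\le x\le 1),\qquad u(0,t)=u(1,t)=0\ (0<t\le T),$$ where $S$ is a source term (for instance $S=0$) and $D_t^\alpha u(x,t)=\frac1{\Gamma(1-\alpha)}\int_0^t(t-s)^{-\alpha}\,\partial_su(x,s)\,ds$ is the Caputo derivative. (Classical means: for each $t\in(0,T]$, $u(\cdot,t)$ is continuous on $[0,1]$ and twice differentiable on $(0,1)$.) Assume that for each $x\in(0,1)$ the function $u(x,\cdot)$ is $C^2$ on $[0,T]$, and that $|\partial_t^2u|\le K$ on $(0,1)\times(0,T)$. Put $c_u=CK$. Let $M\ge1$, $\tau=T/M$, $t_k=k\tau$, $\alpha_i=\kappa_i\tau^{\alpha}\Gamma(2-\alpha)$ for $i=1,2$, and $b_j=(j+1)^{1-\alpha}-j^{1-\alpha}$. Let $u^0=g$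 and let $u^1,\dots,u^M$ (continuous on $[0,1]$, twice differentiable on $(0,1)$, zero at $x=0$ and $x=1$) solve on $(0,1)$ the time-semidiscrete L1 scheme $$u^{1}-\alpha_1\partial_x^2u^{1}+\alpha_2\partial_xu^{1}=u^0+\tau^\alpha\Gamma(2-\alpha)S(\cdot,t_1),$$ $$u^{k+1}-\alpha_1\partial_x^2u^{k+1}+\alpha_2\partial_xu^{k+1}=(1-b_1)u^k+\sum_{j=1}^{k-1}(b_j-b_{j+1})u^{k-j}+b_ku^0+\tau^\alpha\Gamma(2-\alpha)S(\cdot,t_{k+1}),\qquad 1\le k\le M-1.$$ Let $w(x)=e^{-(\kappa_2/\kappa_1)x}$ and $\|v\|_{1,w}^2=\int_0^1v^2w\,dx+\alpha_1\int_0^1(v')^2w\,dx$. Then for every $k=1,\dots,M$ the error $u(\cdot,t_k)-u^k$ has finite energy norm (both integrals converge), and $$\|u(\cdot,t_k)-u^k\|_{1,w}\le\frac{c_u}{1-\alpha}\,T^{\alpha}\tau^{2-\alpha}\qquad\text{and}\qquad\|u(\cdot,t_k)-u^k\|_{1,w}\le c_u\,T\,\tau .$$ Since $C$ is absolute, the second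 bound is uniform in $\alpha\in(0,1)$; in particular it persists as $\alpha\to1$. -/

import Mathlib

/-- The Caputo derivative of order `a > 0` of `f` at `t`, with `m = ⌈a⌉`:
`(1 / Γ (m - a)) ∫₀ᵗ (t - s) ^ (-(a - m + 1)) f⁽ᵐ⁾(s) ds`. -/
noncomputable def caputoDeriv (a : ℝ) (f : ℝ → ℝ) (t : ℝ) : ℝ :=
  1 / Real.Gamma ((⌈a⌉₊ : ℝ) - a) *
    ∫ s in (0 : ℝ)..t, 1 / (t - s) ^ (a - (⌈a⌉₊ : ℝ) + 1) * iteratedDeriv ⌈a⌉₊ f s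

/-- Regularity and boundary values of a classical solution at a fixed time: continuous on `[0,1]`,
twice differentiable on `(0,1)`, and zero at both end points. -/
structure IsClassicalProfile (f : ℝ → ℝ) : Prop where
  continuousOn : ContinuousOn f (Set.Icc 0 1)
  differentiableAt : ∀ x ∈ Set.Ioo (0 : ℝ) 1, DifferentiableAt ℝ f x
  differentiableAt_deriv : ∀ x ∈ Set.Ioo (0 : ℝ) 1, DifferentiableAt ℝ (deriv f) x
  left : f 0 = 0
  right : f 1 = 0

/-- `u = u x t` is a classical solution on `[0,1] × [0,T]` of the time-fractional
advection-dispersion equation `D_t^α u = κ₁ u_xx - κ₂ u_x + S`, with `u(·,0) = g` and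
homogeneous Dirichlet boundary conditions. -/
structure IsExactSolution (α κ₁ κ₂ T : ℝ) (S : ℝ → ℝ → ℝ) (g : ℝ → ℝ) (u : ℝ → ℝ → ℝ) :
    Prop where
  profile : ∀ t ∈ Set.Ioc (0 : ℝ) T, IsClassicalProfile (fun x => u x t)
  initial : ∀ x ∈ Set.Icc (0 : ℝ) 1, u x 0 = g x
  equation : ∀ x ∈ Set.Ioo (0 : ℝ) 1, ∀ t ∈ Set.Ioc (0 : ℝ) T,
    caputoDeriv α (u x) t =
      κ₁ * deriv (deriv (fun y => u y t)) x - κ₂ * deriv (fun y => u y t) x + S x t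

/-- The coefficients `b_j = (j+1)^(1-α) - j^(1-α)` of the L1 scheme. -/
noncomputable def l1Coeff (α : ℝ) (j : ℕ) : ℝ :=
  ((j : ℝ) + 1) ^ (1 - α) - (j : ℝ) ^ (1 - α)

/-- The factor `τ^α Γ(2-α)`; thus `α_i = κ_i τ^α Γ(2-α)` is `κᵢ * stepFactor α τ`. -/
noncomputable def stepFactor (α τ : ℝ) : ℝ :=
  τ ^ α * Real.Gamma (2 - α)

/-- `U 0, …, U M` solve the time-semidiscrete L1 scheme with step `τ` and times `t_k = k τ`. -/
structure IsSemidiscreteSolution (α κ₁ κ₂ τ : ℝ) (M : ℕ) (S : ℝ → ℝ → ℝ) (g : ℝ → ℝ)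
    (U : ℕ → ℝ → ℝ) : Prop where
  profile : ∀ k : ℕ, 1 ≤ k → k ≤ M → IsClassicalProfile (U k)
  initial : ∀ x ∈ Set.Icc (0 : ℝ) 1, U 0 x = g x
  first_step : 1 ≤ M → ∀ x ∈ Set.Ioo (0 : ℝ) 1,
    U 1 x - κ₁ * stepFactor α τ * deriv (deriv (U 1)) x
        + κ₂ * stepFactor α τ * deriv (U 1) x
      = U 0 x + stepFactor α τ * S x τ
  step : ∀ k : ℕ, 1 ≤ k → k + 1 ≤ M → ∀ x ∈ Set.Ioo (0 : ℝ) 1,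
    U (k + 1) x - κ₁ * stepFactor α τ * deriv (deriv (U (k + 1))) x
        + κ₂ * stepFactor α τ * deriv (U (k + 1)) x
      = (1 - l1Coeff α 1) * U k x
        + ∑ j ∈ Finset.Icc 1 (k - 1), (l1Coeff α j - l1Coeff α (j + 1)) * U (k - j) x
        + l1Coeff α k * U 0 x
        + stepFactor α τ * S x (((k : ℝ) + 1) * τ)

/-- The weight `w(x) = exp(-(κ₂/κ₁) x)`. -/
noncomputable def expWeight (κ₁ κ₂ x : ℝ) : ℝ :=
  Real.exp (-(κ₂ / κ₁) * x)

/-- `v` and its derivative are square integrable on `(0,1)` with respect to the weight `w`. -/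
def HasFiniteEnergy (w v : ℝ → ℝ) : Prop :=
  IntervalIntegrable (fun x => v x * v x * w x) MeasureTheory.volume 0 1 ∧
    IntervalIntegrable (fun x => deriv v x * deriv v x * w x) MeasureTheory.volume 0 1

/-- The inner product `(u,v)_w = ∫₀¹ u v w dx`. -/
noncomputable def weightedInner (w u v : ℝ → ℝ) : ℝ :=
  ∫ x in (0 : ℝ)..1, u x * v x * w x

/-- The energy norm `‖v‖_{1,w} = ((v,v)_w + α₁ (v',v')_w)^(1/2)`. -/
noncomputable def energyNorm (α₁ : ℝ) (w v : ℝ → ℝ) : ℝ :=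
  Real.sqrt (weightedInner w v v + α₁ * weightedInner w (deriv v) (deriv v))

/-! The error `e n = u(·, t_n) - U n` satisfies an implicit equation with right side `∑_{j<n} (b_j -
b_{j+1}) e (n - j)` plus a truncation residual; the initial error vanishes.

The residual is at most `2Kτ²` uniformly in `α` (`l1_quadrature_error`). On each cell L1 replaces
`u_t` by its mean. The cell at the singularity costs `Kτ²`. On the others the defect has mean zero,
so only the oscillation of the kernel `σ ^ (-α)` counts, and these oscillations telescope to another
`Kτ²`.

The weight `w` makes the spatial operator symmetric: `(w v')' = w (v'' - (κ₂/κ₁) v')`. Testing with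
`w v` (`IsClassicalProfile.energyNorm_le`) gives the scalar recursion `‖e (n+1)‖ ≤ ∑ (b_j - b_{j+1})
‖e (n-j)‖ + 2Kτ²`, whose weights sum to `1 - b_n`. Two discrete Gronwall bounds follow. The bound `n
· 2Kτ²` gives `2KTτ`; the bound `2Kτ² / b_{n-1}`, with `b_{n-1} ≥ (1-α) n ^ (-α)`, gives order
`2-α`. -/

/-! ### The L1 weights -/

theorem l1Coeff_zero {α : ℝ} (h1 : α < 1) : l1Coeff α 0 = 1 := by
  have : (1 : ℝ) - α ≠ 0 := by linarith
  simp [l1Coeff, Real.zero_rpow this]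

theorem exists_l1Coeff_eq {α : ℝ} (h1 : α < 1) (j : ℕ) :
    ∃ c ∈ Set.Ioo (j : ℝ) (j + 1), l1Coeff α j = (1 - α) * c ^ (-α) := by
  have hj : (0 : ℝ) ≤ j := j.cast_nonneg
  obtain ⟨c, hc, h⟩ := exists_hasDerivAt_eq_slope (fun x : ℝ => x ^ (1 - α))
    (fun x => (1 - α) * x ^ (-α)) (lt_add_one (j : ℝ))
    (continuousOn_id.rpow_const fun x _ => Or.inr (by linarith))
    (fun x hx => by
      have := Real.hasDerivAt_rpow_const (x := x) (p := 1 - α) (Or.inl (by linarith [hx.1]))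
      convert this using 2; ring_nf)
  exact ⟨c, hc, by rw [h, l1Coeff]; simp⟩

theorem l1Coeff_lower {α : ℝ} (h0 : 0 < α) (h1 : α < 1) (j : ℕ) :
    (1 - α) * ((j : ℝ) + 1) ^ (-α) ≤ l1Coeff α j := by
  obtain ⟨c, hc, h⟩ := exists_l1Coeff_eq h1 j
  have hj : (0 : ℝ) ≤ j := j.cast_nonneg
  rw [h]
  exact mul_le_mul_of_nonneg_left
    (Real.rpow_le_rpow_of_nonpos (by linarith [hc.1]) hc.2.le (by linarith)) (by linarith)

theorem l1Coeff_pos {α : ℝ} (h0 : 0 < α) (h1 : α < 1) (j : ℕ) : 0 < l1Coeff α j :=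
  (mul_pos (by linarith) (Real.rpow_pos_of_pos (by positivity) _)).trans_le
    (l1Coeff_lower h0 h1 j)

theorem l1Coeff_antitone {α : ℝ} (h0 : 0 < α) (h1 : α < 1) : Antitone (l1Coeff α) := by
  -- The number `(1 - α) (j + 1) ^ (-α)` separates `b_{j+1}` from `b_j`.
  refine antitone_nat_of_succ_le fun j => le_trans ?_ (l1Coeff_lower h0 h1 j)
  obtain ⟨c, hc, h⟩ := exists_l1Coeff_eq h1 (j + 1)
  push_cast at hc
  rw [h]
  exact mul_le_mul_of_nonneg_left
    (Real.rpow_le_rpow_of_nonpos (by positivity) hc.1.le (by linarith)) (by linarith)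

/-! ### Discrete Gronwall inequalities -/

/-- Discrete Gronwall inequality for a convolution with decreasing weights: linear growth. -/
theorem convolution_gronwall_linear {b a : ℕ → ℝ} {ρ : ℝ} {M : ℕ} (hb0 : b 0 = 1)
    (hb : Antitone b) (hpos : ∀ n, 0 < b n) (hρ : 0 ≤ ρ) (ha : a 0 ≤ 0)
    (h : ∀ n < M, a (n + 1) ≤ ∑ j ∈ Finset.range n, (b j - b (j + 1)) * a (n - j) + ρ) :
    ∀ n ≤ M, a n ≤ n * ρ := by
  intro n
  induction n using Nat.strong_induction_on with
  | _ n ih =>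
    intro hn
    rcases n with _ | n
    · simpa using ha
    have hs : ∑ j ∈ Finset.range n, (b j - b (j + 1)) * a (n - j)
        ≤ ∑ j ∈ Finset.range n, (b j - b (j + 1)) * (n * ρ) := by
      refine Finset.sum_le_sum fun j _ => mul_le_mul_of_nonneg_left ?_
        (sub_nonneg.2 (hb j.le_succ))
      refine (ih (n - j) (by omega) (by omega)).trans (mul_le_mul_of_nonneg_right ?_ hρ)
      exact_mod_cast Nat.sub_le n j
    -- The weights telescope to `1 - b n`; the gain `b n * (n * ρ)` is discarded.
    rw [← Finset.sum_mul, Finset.sum_range_sub', hb0] at hs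
    have h2 : 0 ≤ b n * (n * ρ) := mul_nonneg (hpos n).le (by positivity)
    have := h n hn
    push_cast
    linarith

/-- Discrete Gronwall inequality for a convolution with decreasing weights: growth measured by the
reciprocal weights. -/
theorem convolution_gronwall_inv {b a : ℕ → ℝ} {ρ : ℝ} {M : ℕ} (hb0 : b 0 = 1)
    (hb : Antitone b) (hpos : ∀ n, 0 < b n) (hρ : 0 ≤ ρ)
    (h : ∀ n < M, a (n + 1) ≤ ∑ j ∈ Finset.range n, (b j - b (j + 1)) * a (n - j) + ρ) :
    ∀ n < M, a (n + 1) ≤ ρ / b n := by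
  intro n
  induction n using Nat.strong_induction_on with
  | _ n ih =>
    intro hn
    have hs : ∑ j ∈ Finset.range n, (b j - b (j + 1)) * a (n - j)
        ≤ ∑ j ∈ Finset.range n, (b j - b (j + 1)) * (ρ / b n) := by
      refine Finset.sum_le_sum fun j hj => mul_le_mul_of_nonneg_left ?_
        (sub_nonneg.2 (hb j.le_succ))
      have hj := Finset.mem_range.1 hj
      -- Since `j < n`, the index `n - j` is positive and `a 0` never enters.
      obtain ⟨m, hm⟩ : ∃ m, n - j = m + 1 := ⟨n - j - 1, by omega⟩
      rw [hm]
      exact (ih m (by omega) (by omega)).trans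
        (div_le_div_of_nonneg_left hρ (hpos n) (hb (by omega)))
    -- The bound reproduces itself exactly: `(1 - b n) (ρ / b n) + ρ = ρ / b n`.
    rw [← Finset.sum_mul, Finset.sum_range_sub', hb0, sub_mul, one_mul,
      mul_div_cancel₀ _ (hpos n).ne'] at hs
    linarith [h n hn]

/-! ### Quadrature error for the singular kernel -/

/-- The moment of the kernel `σ ^ (-α)` over the `j`-th cell of width `τ`. -/
theorem integral_kernel_cell {α τ : ℝ} (h1 : α < 1) (hτ : 0 < τ) (j : ℕ) :
    (1 - α) * τ ^ α * ∫ σ in (j * τ)..((j + 1 : ℕ) * τ), σ ^ (-α) = τ * l1Coeff α j := by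
  have h : (0 : ℝ) < 1 - α := by linarith
  rw [integral_rpow (Or.inl (by linarith)), Real.mul_rpow (by positivity) hτ.le,
    Real.mul_rpow (by positivity) hτ.le, l1Coeff, show -α + 1 = 1 - α by ring]
  have : τ ^ α * τ ^ (1 - α) = τ := by rw [← Real.rpow_add hτ]; simp
  push_cast
  field_simp
  linear_combination (((j : ℝ) + 1) ^ (1 - α) - (j : ℝ) ^ (1 - α)) * this

/-- Replacing a function by its mean against a kernel of oscillation at most `d`. -/
theorem abs_integral_mul_sub_le {a b m d δ L : ℝ} {k q : ℝ → ℝ} (hab : a ≤ b)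
    (hk : IntervalIntegrable k MeasureTheory.volume a b) (hq : ContinuousOn q (Set.Icc a b))
    (hkm : ∀ x ∈ Set.Ioc a b, |k x - m| ≤ d) (hqδ : ∀ x ∈ Set.Ioc a b, |q x - δ| ≤ L)
    (hd : 0 ≤ d) (hmean : ∫ x in a..b, q x = δ * (b - a)) :
    |(∫ x in a..b, k x * q x) - δ * ∫ x in a..b, k x| ≤ d * L * (b - a) := by
  have hqi : IntervalIntegrable q MeasureTheory.volume a b :=
    (hq.mono (by rw [Set.uIcc_of_le hab])).intervalIntegrable
  have hkq : IntervalIntegrable (fun x => k x * q x) MeasureTheory.volume a b :=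
    hk.mul_continuousOn (by rwa [Set.uIcc_of_le hab])
  -- Since `q - δ` has mean zero, the constant `m` can be subtracted from `k` at no cost.
  have hE : (∫ x in a..b, k x * q x) - δ * ∫ x in a..b, k x
      = ∫ x in a..b, (k x - m) * (q x - δ) := by
    have : (fun x => (k x - m) * (q x - δ))
        = fun x => (k x * q x - δ * k x) - (m * q x - m * δ) := by ext x; ring
    rw [this, intervalIntegral.integral_sub (hkq.sub (hk.const_mul δ))
      ((hqi.const_mul m).sub intervalIntegrable_const),
      intervalIntegral.integral_sub hkq (hk.const_mul δ),
      intervalIntegral.integral_sub (hqi.const_mul m) intervalIntegrable_const,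
      intervalIntegral.integral_const_mul, intervalIntegral.integral_const_mul, hmean]
    simp; ring
  rw [hE, ← abs_of_nonneg (sub_nonneg.2 hab), ← Real.norm_eq_abs]
  refine intervalIntegral.norm_integral_le_of_norm_le_const fun x hx => ?_
  rw [Set.uIoc_of_le hab] at hx
  rw [norm_mul]
  exact mul_le_mul (hkm x hx) (hqδ x hx) (norm_nonneg _) hd

/-- Replacing a function by a nearby constant against a nonnegative kernel. -/
theorem abs_integral_mul_sub_le_mul_integral {a b δ L : ℝ} {k q : ℝ → ℝ} (hab : a ≤ b)
    (hk : IntervalIntegrable k MeasureTheory.volume a b) (hq : ContinuousOn q (Set.Icc a b))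
    (hk0 : ∀ x ∈ Set.Ioc a b, 0 ≤ k x) (hqδ : ∀ x ∈ Set.Ioc a b, |q x - δ| ≤ L) :
    |(∫ x in a..b, k x * q x) - δ * ∫ x in a..b, k x| ≤ L * ∫ x in a..b, k x := by
  have hkq : IntervalIntegrable (fun x => k x * q x) MeasureTheory.volume a b :=
    hk.mul_continuousOn (by rwa [Set.uIcc_of_le hab])
  rw [← intervalIntegral.integral_const_mul (r := δ), ← intervalIntegral.integral_const_mul (r := L),
    ← intervalIntegral.integral_sub hkq (hk.const_mul δ), ← Real.norm_eq_abs]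
  refine intervalIntegral.norm_integral_le_of_norm_le hab
    (Filter.Eventually.of_forall fun x hx => ?_) (hk.const_mul L)
  rw [show k x * q x - δ * k x = (q x - δ) * k x by ring, norm_mul, Real.norm_of_nonneg (hk0 x hx)]
  exact mul_le_mul_of_nonneg_right (hqδ x hx) (hk0 x hx)

/-- The L1 quadrature error for the kernel `σ ^ (-α)` on `[0, N τ]`: `F` is a function with
`K`-Lipschitz derivative `q`. -/
theorem l1_quadrature_error {α τ K : ℝ} {N : ℕ} {F q : ℝ → ℝ} (h0 : 0 < α) (h1 : α < 1)
    (hτ : 0 < τ) (hK : 0 ≤ K) (hF : ContinuousOn F (Set.Icc 0 (N * τ)))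
    (hderiv : ∀ σ ∈ Set.Ioo 0 (N * τ), HasDerivAt F (q σ) σ)
    (hq : ContinuousOn q (Set.Icc 0 (N * τ)))
    (hlip : ∀ x ∈ Set.Icc 0 (N * τ), ∀ y ∈ Set.Icc 0 (N * τ), |q x - q y| ≤ K * |x - y|) :
    |(1 - α) * τ ^ α * (∫ σ in (0 : ℝ)..(N * τ), σ ^ (-α) * q σ)
      - ∑ j ∈ Finset.range N, l1Coeff α j * (F ((j + 1 : ℕ) * τ) - F (j * τ))|
      ≤ 2 * K * τ ^ 2 := by
  have hα : (0 : ℝ) < 1 - α := by linarith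
  have hki : ∀ a b, IntervalIntegrable (fun σ : ℝ => σ ^ (-α)) MeasureTheory.volume a b :=
    fun a b => intervalIntegral.intervalIntegrable_rpow' (by linarith)
  have hcell : ∀ j < N, Set.Icc (j * τ) ((j + 1 : ℕ) * τ) ⊆ Set.Icc 0 (N * τ) := by
    intro j hj
    refine Set.Icc_subset_Icc (by positivity) (mul_le_mul_of_nonneg_right ?_ hτ.le)
    exact_mod_cast hj
  have hle : ∀ j : ℕ, (j : ℝ) * τ < (j + 1 : ℕ) * τ := fun j =>
    mul_lt_mul_of_pos_right (by push_cast; linarith) hτ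
  have hlen : ∀ j : ℕ, ((j + 1 : ℕ) : ℝ) * τ - j * τ = τ := fun j => by push_cast; ring
  have hint : ∀ j < N, IntervalIntegrable (fun σ => σ ^ (-α) * q σ) MeasureTheory.volume
      (j * τ) ((j + 1 : ℕ) * τ) := fun j hj =>
    (hki _ _).mul_continuousOn (by
      rw [Set.uIcc_of_le (hle j).le]; exact hq.mono (hcell j hj))
  have hsplit : ∫ σ in (0 : ℝ)..(N * τ), σ ^ (-α) * q σ
      = ∑ j ∈ Finset.range N, ∫ σ in (j * τ)..((j + 1 : ℕ) * τ), σ ^ (-α) * q σ := by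
    rw [intervalIntegral.sum_integral_adjacent_intervals (a := fun j : ℕ => (j : ℝ) * τ) hint]
    simp
  set E : ℕ → ℝ := fun j => (1 - α) * τ ^ α * (∫ σ in (j * τ)..((j + 1 : ℕ) * τ), σ ^ (-α) * q σ)
    - l1Coeff α j * (F ((j + 1 : ℕ) * τ) - F (j * τ)) with hE
  rw [hsplit, Finset.mul_sum, ← Finset.sum_sub_distrib]
  -- The slope `δ` of `F` on a cell is a value `q c` taken there, hence within `K * τ` of `q`; it is
  -- also the mean of `q`.
  have key : ∀ j < N, ∃ δ, F ((j + 1 : ℕ) * τ) - F (j * τ) = δ * τ ∧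
      (∫ x in (j * τ)..((j + 1 : ℕ) * τ), q x = δ * ((j + 1 : ℕ) * τ - j * τ)) ∧
      ∀ x ∈ Set.Ioc (j * τ) ((j + 1 : ℕ) * τ), |q x - δ| ≤ K * τ := by
    intro j hj
    have hsub := hcell j hj
    have hsub' : Set.Ioo (j * τ) ((j + 1 : ℕ) * τ) ⊆ Set.Ioo 0 (N * τ) := by
      intro x hx
      exact ⟨lt_of_le_of_lt (by positivity) hx.1,
        lt_of_lt_of_le hx.2 (hsub (Set.right_mem_Icc.2 (hle j).le)).2⟩
    obtain ⟨c, hc, hs⟩ := exists_hasDerivAt_eq_slope F q (hle j) (hF.mono hsub)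
      (fun x hx => hderiv x (hsub' hx))
    have hslope : F ((j + 1 : ℕ) * τ) - F (j * τ) = q c * τ := by
      rw [hs, hlen]; field_simp
    refine ⟨q c, hslope, ?_, fun x hx => ?_⟩
    · rw [intervalIntegral.integral_eq_sub_of_hasDerivAt_of_le (hle j).le (hF.mono hsub)
        (fun x hx => hderiv x (hsub' hx))
        ((hq.mono (by rw [Set.uIcc_of_le (hle j).le]; exact hsub)).intervalIntegrable),
        hslope, hlen]
    · refine (hlip x (hsub ⟨hx.1.le, hx.2⟩) c (hsub ⟨hc.1.le, hc.2.le⟩)).trans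
        (mul_le_mul_of_nonneg_left ?_ hK)
      rw [abs_le]
      have := hlen j
      constructor <;> linarith [hx.1, hx.2, hc.1, hc.2]
  have hform : ∀ j, ∀ δ, F ((j + 1 : ℕ) * τ) - F (j * τ) = δ * τ → E j = (1 - α) * τ ^ α *
      ((∫ σ in (j * τ)..((j + 1 : ℕ) * τ), σ ^ (-α) * q σ)
        - δ * ∫ σ in (j * τ)..((j + 1 : ℕ) * τ), σ ^ (-α)) := by
    intro j δ hδ
    simp only [hE]
    rw [hδ]
    linear_combination δ * integral_kernel_cell h1 hτ j
  have hc0 : 0 ≤ (1 - α) * τ ^ α := by positivity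
  -- The kernel is unbounded on this cell, so its mass is used instead of its oscillation: scaled by
  -- `(1 - α) * τ ^ α`, it equals `τ`.
  have hfirst : 0 < N → |E 0| ≤ K * τ ^ 2 := by
    intro hN
    obtain ⟨δ, h, -, hb⟩ := key 0 hN
    have := abs_integral_mul_sub_le_mul_integral (hle 0).le (hki _ _) (hq.mono (hcell 0 hN))
      (fun x hx => Real.rpow_nonneg (le_trans (by positivity) hx.1.le) _) hb
    rw [hform 0 δ h, abs_mul, abs_of_nonneg hc0]
    refine (mul_le_mul_of_nonneg_left this hc0).trans (le_of_eq ?_)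
    have h3 := integral_kernel_cell h1 hτ 0
    rw [l1Coeff_zero h1] at h3
    linear_combination K * τ * h3
  have hrest : ∀ j, j + 1 < N →
      |E (j + 1)| ≤ K * τ ^ 2 * (((j + 1 : ℕ) : ℝ) ^ (-α) - ((j + 2 : ℕ) : ℝ) ^ (-α)) := by
    intro j hj
    obtain ⟨δ, h, hmean, hb⟩ := key (j + 1) hj
    have hp : (0 : ℝ) < (j + 1 : ℕ) * τ := by positivity
    -- The kernel decreases, so with `m` its value at the right end, its oscillation is a difference
    -- of end values, ready to telescope.
    have hkm : ∀ x ∈ Set.Ioc (((j + 1 : ℕ) : ℝ) * τ) ((j + 1 + 1 : ℕ) * τ),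
        |x ^ (-α) - (((j + 2 : ℕ) : ℝ) * τ) ^ (-α)| ≤
          (((j + 1 : ℕ) : ℝ) * τ) ^ (-α) - (((j + 2 : ℕ) : ℝ) * τ) ^ (-α) := by
      intro x hx
      have i1 : x ^ (-α) ≤ (((j + 1 : ℕ) : ℝ) * τ) ^ (-α) :=
        Real.rpow_le_rpow_of_nonpos hp hx.1.le (by linarith)
      have i2 : (((j + 2 : ℕ) : ℝ) * τ) ^ (-α) ≤ x ^ (-α) :=
        Real.rpow_le_rpow_of_nonpos (hp.trans hx.1) hx.2 (by linarith)
      rw [abs_of_nonneg (by linarith)]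
      linarith
    have hd : 0 ≤ (((j + 1 : ℕ) : ℝ) * τ) ^ (-α) - (((j + 2 : ℕ) : ℝ) * τ) ^ (-α) :=
      (abs_nonneg _).trans (hkm _ (Set.right_mem_Ioc.2 (hle (j + 1))))
    have := abs_integral_mul_sub_le (hle (j + 1)).le (hki _ _) (hq.mono (hcell _ hj)) hkm hb hd hmean
    rw [hform _ δ h, abs_mul, abs_of_nonneg hc0]
    refine (mul_le_mul_of_nonneg_left this hc0).trans ?_
    rw [hlen, Real.mul_rpow (by positivity) hτ.le, Real.mul_rpow (by positivity) hτ.le] at *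
    have hττ : τ ^ α * τ ^ (-α) = 1 := by rw [← Real.rpow_add hτ]; simp
    have hd' : 0 ≤ ((j + 1 : ℕ) : ℝ) ^ (-α) - ((j + 2 : ℕ) : ℝ) ^ (-α) := by
      rw [← sub_mul] at hd
      exact nonneg_of_mul_nonneg_left hd (Real.rpow_pos_of_pos hτ _)
    calc _ = (1 - α) * (K * τ ^ 2 * (((j + 1 : ℕ) : ℝ) ^ (-α) - ((j + 2 : ℕ) : ℝ) ^ (-α))) := by
          linear_combination (1 - α) * (K * τ ^ 2 *
            (((j + 1 : ℕ) : ℝ) ^ (-α) - ((j + 2 : ℕ) : ℝ) ^ (-α))) * hττ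
      _ ≤ _ := mul_le_of_le_one_left (by positivity) (by linarith)
  rcases N with _ | N
  · simp; positivity
  rw [Finset.sum_range_succ']
  refine (abs_add_le _ _).trans ?_
  -- The sum telescopes to `1 - (N + 1) ^ (-α) ≤ 1`.
  have hsum : |∑ j ∈ Finset.range N, E (j + 1)| ≤ K * τ ^ 2 := by
    refine (Finset.abs_sum_le_sum_abs _ _).trans ((Finset.sum_le_sum fun j hj =>
      hrest j (by have := Finset.mem_range.1 hj; omega)).trans ?_)
    rw [← Finset.mul_sum, Finset.sum_range_sub' (fun j : ℕ => ((j + 1 : ℕ) : ℝ) ^ (-α))]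
    refine mul_le_of_le_one_right (by positivity) ?_
    have : 0 ≤ ((N + 1 : ℕ) : ℝ) ^ (-α) := by positivity
    simp only [zero_add, Nat.cast_one, Real.one_rpow]
    linarith
  have := hfirst (Nat.succ_pos N)
  linarith

/-! ### Truncation error for the Caputo derivative -/

/-- On the interior, the derivative within a closed interval is the derivative; it is Lipschitz as
soon as the second derivative is bounded there. -/
theorem abs_derivWithin_sub_le {f : ℝ → ℝ} {T K : ℝ} (hT : 0 < T)
    (hf : ContDiffOn ℝ 2 f (Set.Icc 0 T)) (hK : ∀ t ∈ Set.Ioo 0 T, |iteratedDeriv 2 f t| ≤ K) :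
    ∀ x ∈ Set.Icc 0 T, ∀ y ∈ Set.Icc 0 T,
      |derivWithin f (Set.Icc 0 T) x - derivWithin f (Set.Icc 0 T) y| ≤ K * |x - y| := by
  have hu : UniqueDiffOn ℝ (Set.Icc 0 T) := uniqueDiffOn_Icc hT
  have hp : ContDiffOn ℝ 1 (derivWithin f (Set.Icc 0 T)) (Set.Icc 0 T) :=
    hf.derivWithin hu (by norm_num)
  have hdp : ∀ t ∈ Set.Ioo 0 T,
      HasDerivAt (derivWithin f (Set.Icc 0 T)) (iteratedDeriv 2 f t) t := by
    intro t ht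
    have hn : Set.Icc 0 T ∈ nhds t := Icc_mem_nhds ht.1 ht.2
    have hd := ((hp.differentiableOn (by norm_num)) t ⟨ht.1.le, ht.2.le⟩).differentiableAt hn
    have he : derivWithin f (Set.Icc 0 T) =ᶠ[nhds t] deriv f := by
      filter_upwards [isOpen_Ioo.mem_nhds ht] with s hs
      exact derivWithin_of_mem_nhds (Icc_mem_nhds hs.1 hs.2)
    have := hd.hasDerivAt
    rwa [he.deriv_eq, show deriv (deriv f) t = iteratedDeriv 2 f t by
      rw [iteratedDeriv_succ, iteratedDeriv_one]] at this
  have main : ∀ x ∈ Set.Icc 0 T, ∀ y ∈ Set.Icc 0 T, x < y →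
      |derivWithin f (Set.Icc 0 T) x - derivWithin f (Set.Icc 0 T) y| ≤ K * |x - y| := by
    intro x hx y hy hxy
    have hsub : Set.Ioo x y ⊆ Set.Ioo 0 T := Set.Ioo_subset_Ioo hx.1 hy.2
    obtain ⟨c, hc, hs⟩ := exists_hasDerivAt_eq_slope _ _ hxy
      (hp.continuousOn.mono (Set.Icc_subset_Icc hx.1 hy.2)) (fun s hs => hdp s (hsub hs))
    have hyx : 0 < y - x := sub_pos.2 hxy
    rw [eq_div_iff hyx.ne'] at hs
    rw [abs_sub_comm, ← hs, abs_mul, abs_sub_comm x y]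
    exact mul_le_mul_of_nonneg_right (hK c (hsub hc)) (abs_nonneg _)
  intro x hx y hy
  rcases lt_trichotomy x y with h | h | h
  · exact main x hx y hy h
  · simp [h]
  · rw [abs_sub_comm, abs_sub_comm x]; exact main y hy x hx h

/-- The identity `Γ(2-α) = (1-α) Γ(1-α)` cancels the Gamma factor, and reversing time puts the
singularity at `0`, so that cell `j` carries the weight `b_j`. -/
theorem stepFactor_mul_caputoDeriv {α τ t : ℝ} {f : ℝ → ℝ} (h0 : 0 < α) (h1 : α < 1)
    (ht : 0 ≤ t) :
    stepFactor α τ * caputoDeriv α f t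
      = (1 - α) * τ ^ α * ∫ σ in (0 : ℝ)..t, σ ^ (-α) * deriv f (t - σ) := by
  have hceil : ⌈α⌉₊ = 1 := (Nat.ceil_eq_iff one_ne_zero).2 (by simpa using ⟨h0, h1.le⟩)
  have hα : (0 : ℝ) < 1 - α := by linarith
  have hG : Real.Gamma (2 - α) = (1 - α) * Real.Gamma (1 - α) := by
    rw [← Real.Gamma_add_one hα.ne']; ring_nf
  have hI : ∫ s in (0 : ℝ)..t, 1 / (t - s) ^ (α - (⌈α⌉₊ : ℝ) + 1) * iteratedDeriv ⌈α⌉₊ f s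
      = ∫ σ in (0 : ℝ)..t, σ ^ (-α) * deriv f (t - σ) := by
    have h2 := intervalIntegral.integral_comp_sub_left (a := 0) (b := t)
      (fun σ => σ ^ (-α) * deriv f (t - σ)) t
    simp only [sub_sub_cancel, sub_self, sub_zero] at h2
    rw [← h2]
    refine intervalIntegral.integral_congr fun s hs => ?_
    rw [Set.uIcc_of_le ht] at hs
    simp only [hceil, iteratedDeriv_one, Nat.cast_one, sub_add_cancel]
    rw [Real.rpow_neg (by linarith [hs.2]), one_div]
  have := (Real.Gamma_pos_of_pos hα).ne'
  rw [caputoDeriv, hI, stepFactor, hG, hceil, Nat.cast_one]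
  field_simp

/-- Truncation error of the L1 approximation of the Caputo derivative. -/
theorem l1_truncation_error {α τ K T : ℝ} {N : ℕ} {f : ℝ → ℝ} (h0 : 0 < α) (h1 : α < 1)
    (hτ : 0 < τ) (hN : 0 < N) (hNT : N * τ ≤ T) (hf : ContDiffOn ℝ 2 f (Set.Icc 0 T))
    (hK : ∀ t ∈ Set.Ioo 0 T, |iteratedDeriv 2 f t| ≤ K) :
    |stepFactor α τ * caputoDeriv α f (N * τ)
      - ∑ j ∈ Finset.range N, l1Coeff α j * (f ((N - j : ℕ) * τ) - f ((N - (j + 1) : ℕ) * τ))|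
      ≤ 2 * K * τ ^ 2 := by
  have ht : 0 < N * τ := by positivity
  have hT : 0 < T := ht.trans_le hNT
  have hK0 : 0 ≤ K := (abs_nonneg _).trans (hK (T / 2) ⟨by linarith, by linarith⟩)
  -- Nothing is known of `f` outside `[0, T]`, so `deriv f` is uncontrolled at the end points; `p`
  -- is continuous up to them and agrees with `deriv f` inside, which is all the integral sees.
  set p := derivWithin f (Set.Icc 0 T) with hp
  have hpc : ContinuousOn p (Set.Icc 0 T) :=
    hf.continuousOn_derivWithin (uniqueDiffOn_Icc hT) (by norm_num)
  have hmaps : Set.MapsTo (fun σ => N * τ - σ) (Set.Icc 0 (N * τ)) (Set.Icc 0 T) :=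
    fun σ hσ => ⟨by linarith [hσ.2], by linarith [hσ.1]⟩
  have hder : ∀ σ ∈ Set.Ioo 0 (N * τ), p (N * τ - σ) = deriv f (N * τ - σ) := fun σ hσ =>
    derivWithin_of_mem_nhds (Icc_mem_nhds (by linarith [hσ.2]) (by linarith [hσ.1]))
  have hlip := abs_derivWithin_sub_le hT hf hK
  have hquad := l1_quadrature_error (N := N) (F := fun σ => f (N * τ - σ))
    (q := fun σ => -p (N * τ - σ)) h0 h1 hτ hK0
    (hf.continuousOn.comp (by fun_prop) hmaps)
    (fun σ hσ => by
      have hd : HasDerivAt f (p (N * τ - σ)) (N * τ - σ) :=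
        ((hf.differentiableOn (by norm_num)) _ (hmaps ⟨hσ.1.le, hσ.2.le⟩)).hasDerivWithinAt.hasDerivAt
          (Icc_mem_nhds (by linarith [hσ.2]) (by linarith [hσ.1]))
      have := hd.comp σ ((hasDerivAt_id σ).const_sub (N * τ))
      exact this.congr_deriv (by simp))
    (hpc.comp (by fun_prop) hmaps).neg
    (fun x hx y hy => by
      have := hlip _ (hmaps hx) _ (hmaps hy)
      rw [← abs_neg]
      convert this using 2
      · ring
      · rw [← abs_neg]; ring_nf)
  rw [stepFactor_mul_caputoDeriv h0 h1 ht.le]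
  have hI : ∫ σ in (0 : ℝ)..(N * τ), σ ^ (-α) * deriv f (N * τ - σ)
      = -∫ σ in (0 : ℝ)..(N * τ), σ ^ (-α) * -p (N * τ - σ) := by
    rw [← intervalIntegral.integral_neg]
    refine intervalIntegral.integral_congr_Ioo_of_le ht.le fun σ hσ => ?_
    simp only [hder σ hσ]
    ring
  have hS : ∑ j ∈ Finset.range N,
        l1Coeff α j * (f ((N - j : ℕ) * τ) - f ((N - (j + 1) : ℕ) * τ))
      = -∑ j ∈ Finset.range N, l1Coeff α j *
        (f (N * τ - (j + 1 : ℕ) * τ) - f (N * τ - j * τ)) := by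
    rw [← Finset.sum_neg_distrib]
    refine Finset.sum_congr rfl fun j hj => ?_
    have := Finset.mem_range.1 hj
    rw [Nat.cast_sub this.le, Nat.cast_sub (show j + 1 ≤ N from this), sub_mul, sub_mul]
    ring
  rw [hI, hS, ← abs_neg]
  refine le_of_eq_of_le ?_ hquad
  congr 1
  ring

/-- Summation by parts for the L1 scheme. -/
theorem sum_mul_backward_diff {b : ℕ → ℝ} (hb0 : b 0 = 1) (y : ℕ → ℝ) (n : ℕ) :
    ∑ j ∈ Finset.range (n + 1), b j * (y (n + 1 - j) - y (n + 1 - (j + 1)))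
      = y (n + 1) - ∑ j ∈ Finset.range n, (b j - b (j + 1)) * y (n - j) - b n * y 0 := by
  simp only [mul_sub, sub_mul, Finset.sum_sub_distrib, Nat.add_sub_add_right]
  rw [Finset.sum_range_succ', Finset.sum_range_succ (fun j => b j * y (n - j))]
  simp only [Nat.add_sub_add_right, hb0, Nat.sub_self, Nat.sub_zero]
  ring

/-! ### The weighted inner product -/

theorem continuous_expWeight (κ₁ κ₂ : ℝ) : Continuous (expWeight κ₁ κ₂) := by
  unfold expWeight; fun_prop

theorem expWeight_pos (κ₁ κ₂ x : ℝ) : 0 < expWeight κ₁ κ₂ x := Real.exp_pos _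

theorem expWeight_le_one {κ₁ κ₂ x : ℝ} (h₁ : 0 < κ₁) (h₂ : 0 ≤ κ₂) (hx : 0 ≤ x) :
    expWeight κ₁ κ₂ x ≤ 1 :=
  Real.exp_le_one_iff.2 (by
    have : 0 ≤ κ₂ / κ₁ * x := by positivity
    linarith)

theorem hasDerivAt_expWeight (κ₁ κ₂ x : ℝ) :
    HasDerivAt (expWeight κ₁ κ₂) (-(κ₂ / κ₁) * expWeight κ₁ κ₂ x) x := by
  have := ((hasDerivAt_id x).const_mul (-(κ₂ / κ₁))).exp
  exact this.congr_deriv (by simp [expWeight, mul_comm])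

theorem intervalIntegrable_mul_weight {w f g : ℝ → ℝ} (hw : Continuous w)
    (hf : ContinuousOn f (Set.Icc 0 1)) (hg : ContinuousOn g (Set.Icc 0 1)) :
    IntervalIntegrable (fun x => f x * g x * w x) MeasureTheory.volume 0 1 :=
  ContinuousOn.intervalIntegrable (by
    rw [Set.uIcc_of_le zero_le_one]
    exact (hf.mul hg).mul hw.continuousOn)

theorem weightedInner_self_nonneg {w : ℝ → ℝ} (hw : ∀ x, 0 ≤ w x) (f : ℝ → ℝ) :
    0 ≤ weightedInner w f f :=
  intervalIntegral.integral_nonneg zero_le_one fun x _ => mul_nonneg (mul_self_nonneg _) (hw x)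

theorem sqrt_weightedInner_le_energyNorm {a : ℝ} {w : ℝ → ℝ} (ha : 0 ≤ a) (hw : ∀ x, 0 ≤ w x)
    (f : ℝ → ℝ) : √(weightedInner w f f) ≤ energyNorm a w f :=
  Real.sqrt_le_sqrt (le_add_of_nonneg_right
    (mul_nonneg ha (weightedInner_self_nonneg hw _)))

/-- Cauchy-Schwarz for the weighted inner product. -/
theorem weightedInner_le {w f g : ℝ → ℝ} (hw : Continuous w) (hw0 : ∀ x, 0 ≤ w x)
    (hf : ContinuousOn f (Set.Icc 0 1)) (hg : ContinuousOn g (Set.Icc 0 1)) :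
    weightedInner w f g ≤ √(weightedInner w f f) * √(weightedInner w g g) := by
  have h : ∀ t : ℝ, 0 ≤ weightedInner w f f * (t * t) + 2 * weightedInner w f g * t
      + weightedInner w g g := by
    intro t
    have hn : 0 ≤ ∫ x in (0 : ℝ)..1, (t * f x + g x) * (t * f x + g x) * w x :=
      weightedInner_self_nonneg hw0 fun x => t * f x + g x
    have he : (fun x => (t * f x + g x) * (t * f x + g x) * w x) = fun x =>
        t * t * (f x * f x * w x) + 2 * t * (f x * g x * w x) + g x * g x * w x := by
      ext x; ring
    have iff := (intervalIntegrable_mul_weight hw hf hf).const_mul (t * t)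
    have ifg := (intervalIntegrable_mul_weight hw hf hg).const_mul (2 * t)
    rw [he, intervalIntegral.integral_add (iff.add ifg) (intervalIntegrable_mul_weight hw hg hg),
      intervalIntegral.integral_add iff ifg, intervalIntegral.integral_const_mul,
      intervalIntegral.integral_const_mul] at hn
    simp only [weightedInner]
    linarith
  have hd := discrim_le_zero h
  rw [discrim] at hd
  rw [← Real.sqrt_mul (weightedInner_self_nonneg hw0 f)]
  exact Real.le_sqrt_of_sq_le (by linarith)

theorem weightedInner_sum {ι : Type*} {w f : ℝ → ℝ} (hw : Continuous w)
    (hf : ContinuousOn f (Set.Icc 0 1)) (s : Finset ι) (c : ι → ℝ) (g : ι → ℝ → ℝ)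
    (hg : ∀ i ∈ s, ContinuousOn (g i) (Set.Icc 0 1)) :
    weightedInner w f (fun x => ∑ i ∈ s, c i * g i x) = ∑ i ∈ s, c i * weightedInner w f (g i) := by
  simp only [weightedInner, ← intervalIntegral.integral_const_mul]
  rw [← intervalIntegral.integral_finsetSum fun i hi =>
    (intervalIntegrable_mul_weight hw hf (hg i hi)).const_mul (c i)]
  congr 1; ext x
  rw [Finset.mul_sum, Finset.sum_mul]
  exact Finset.sum_congr rfl fun i _ => by ring

/-! ### Energy estimate for one implicit step -/

/-- Second derivatives of classical profiles need not be continuous, but a `deriv` is always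
measurable, so boundedness suffices. -/
theorem intervalIntegrable_of_bounded {f : ℝ → ℝ} {B : ℝ} (hf : Measurable f)
    (hB : ∀ x ∈ Set.Ioo (0 : ℝ) 1, |f x| ≤ B) :
    IntervalIntegrable f MeasureTheory.volume 0 1 := by
  rw [intervalIntegrable_iff_integrableOn_Ioo_of_le zero_le_one]
  exact MeasureTheory.IntegrableOn.of_bound (by simp) hf.aestronglyMeasurable B
    ((MeasureTheory.ae_restrict_iff' measurableSet_Ioo).2 (Filter.Eventually.of_forall hB))

/-- If `v'' - (κ₂/κ₁) v'` is bounded on `(0,1)`, then so is `v'`. -/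
theorem IsClassicalProfile.exists_deriv_bound {κ₁ κ₂ B : ℝ} {v : ℝ → ℝ}
    (hv : IsClassicalProfile v) (h₁ : 0 < κ₁) (h₂ : 0 ≤ κ₂)
    (hB : ∀ x ∈ Set.Ioo (0 : ℝ) 1, |deriv (deriv v) x - κ₂ / κ₁ * deriv v x| ≤ B) :
    ∃ D, ∀ x ∈ Set.Ioo (0 : ℝ) 1, |deriv v x| ≤ D := by
  set w := expWeight κ₁ κ₂ with hw
  -- The weight is the integrating factor: `w v'` has derivative bounded by `B`, so it stays within
  -- `B` of its value at `1/2`.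
  have hd : ∀ x ∈ Set.Ioo (0 : ℝ) 1, HasDerivWithinAt (fun x => w x * deriv v x)
      (w x * (deriv (deriv v) x - κ₂ / κ₁ * deriv v x)) (Set.Ioo 0 1) x := by
    intro x hx
    have := ((hasDerivAt_expWeight κ₁ κ₂ x).mul (hv.differentiableAt_deriv x hx).hasDerivAt)
    refine (this.congr_deriv ?_).hasDerivWithinAt
    ring
  have hB' : ∀ x ∈ Set.Ioo (0 : ℝ) 1, ‖w x * (deriv (deriv v) x - κ₂ / κ₁ * deriv v x)‖ ≤ B := by
    intro x hx
    rw [norm_mul, Real.norm_of_nonneg (expWeight_pos ..).le]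
    exact (mul_le_of_le_one_left (norm_nonneg _) (expWeight_le_one h₁ h₂ hx.1.le)).trans (hB x hx)
  have hmid : (1 / 2 : ℝ) ∈ Set.Ioo (0 : ℝ) 1 := by norm_num
  have hB0 : 0 ≤ B := (abs_nonneg _).trans (hB _ hmid)
  have hmin : ∀ x ∈ Set.Ioo (0 : ℝ) 1, w 1 ≤ w x := fun x hx =>
    Real.exp_le_exp.2 (mul_le_mul_of_nonpos_left hx.2.le (by
      have : 0 ≤ κ₂ / κ₁ := by positivity
      linarith))
  refine ⟨(B + |w (1 / 2) * deriv v (1 / 2)|) / w 1, fun x hx => ?_⟩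
  have hm := (convex_Ioo (0 : ℝ) 1).norm_image_sub_le_of_norm_hasDerivWithin_le hd hB' hmid hx
  have hx1 : ‖x - 1 / 2‖ ≤ 1 := by
    rw [Real.norm_eq_abs, abs_le]; constructor <;> linarith [hx.1, hx.2]
  have hwv : |w x * deriv v x| ≤ B + |w (1 / 2) * deriv v (1 / 2)| := by
    have := norm_le_insert' (w x * deriv v x) (w (1 / 2) * deriv v (1 / 2))
    simp only [Real.norm_eq_abs] at *
    nlinarith [mul_le_mul_of_nonneg_left hx1 hB0]
  rw [le_div_iff₀ (expWeight_pos ..), mul_comm]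
  refine le_trans (mul_le_mul_of_nonneg_right (hmin x hx) (abs_nonneg _)) ?_
  rwa [abs_mul, abs_of_pos (expWeight_pos ..)] at hwv

/-- Energy identity for the operator `v ↦ v'' - (κ₂/κ₁) v'`, which is symmetric for the weight. -/
theorem IsClassicalProfile.energy_identity {κ₁ κ₂ B : ℝ} {v : ℝ → ℝ}
    (hv : IsClassicalProfile v) (h₁ : 0 < κ₁) (h₂ : 0 ≤ κ₂)
    (hB : ∀ x ∈ Set.Ioo (0 : ℝ) 1, |deriv (deriv v) x - κ₂ / κ₁ * deriv v x| ≤ B) :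
    HasFiniteEnergy (expWeight κ₁ κ₂) v ∧
      IntervalIntegrable
        (fun x => v x * (deriv (deriv v) x - κ₂ / κ₁ * deriv v x) * expWeight κ₁ κ₂ x)
        MeasureTheory.volume 0 1 ∧
      weightedInner (expWeight κ₁ κ₂) (deriv v) (deriv v) +
        weightedInner (expWeight κ₁ κ₂) v (fun x => deriv (deriv v) x - κ₂ / κ₁ * deriv v x)
        = 0 := by
  obtain ⟨D, hD⟩ := hv.exists_deriv_bound h₁ h₂ hB
  have hw := continuous_expWeight κ₁ κ₂
  have hmd := measurable_deriv v
  have hmdd := measurable_deriv (deriv v)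
  have hdd : IntervalIntegrable (fun x => deriv v x * deriv v x * expWeight κ₁ κ₂ x)
      MeasureTheory.volume 0 1 := by
    refine intervalIntegrable_of_bounded (B := D * D) ((hmd.mul hmd).mul hw.measurable)
      fun x hx => ?_
    have h0 := abs_nonneg (deriv v x)
    rw [abs_mul, abs_mul, abs_of_pos (expWeight_pos ..)]
    exact (mul_le_of_le_one_right (by positivity) (expWeight_le_one h₁ h₂ hx.1.le)).trans
      (mul_self_le_mul_self h0 (hD x hx))
  have hvF : IntervalIntegrable
      (fun x => v x * (deriv (deriv v) x - κ₂ / κ₁ * deriv v x) * expWeight κ₁ κ₂ x)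
      MeasureTheory.volume 0 1 := by
    have hF : IntervalIntegrable
        (fun x => (deriv (deriv v) x - κ₂ / κ₁ * deriv v x) * expWeight κ₁ κ₂ x)
        MeasureTheory.volume 0 1 := by
      refine intervalIntegrable_of_bounded (B := B)
        ((hmdd.sub (hmd.const_mul _)).mul hw.measurable) fun x hx => ?_
      rw [abs_mul, abs_of_pos (expWeight_pos ..)]
      exact (mul_le_of_le_one_right (abs_nonneg _) (expWeight_le_one h₁ h₂ hx.1.le)).trans (hB x hx)
    simpa only [mul_assoc] using
      hF.continuousOn_mul (by rw [Set.uIcc_of_le zero_le_one]; exact hv.continuousOn)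
  refine ⟨⟨intervalIntegrable_mul_weight hw hv.continuousOn hv.continuousOn, hdd⟩, hvF, ?_⟩
  rw [weightedInner, weightedInner, ← intervalIntegral.integral_add hdd hvF]
  have hderiv : ∀ x ∈ Set.Ioo (0 : ℝ) 1,
      HasDerivAt (fun x => v x * deriv v x * expWeight κ₁ κ₂ x)
      (deriv v x * deriv v x * expWeight κ₁ κ₂ x +
        v x * (deriv (deriv v) x - κ₂ / κ₁ * deriv v x) * expWeight κ₁ κ₂ x) x := by
    intro x hx
    refine (((hv.differentiableAt x hx).hasDerivAt.mul
      (hv.differentiableAt_deriv x hx).hasDerivAt).mul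
        (hasDerivAt_expWeight κ₁ κ₂ x)).congr_deriv ?_
    simp only [Pi.mul_apply]
    ring
  -- Boundary terms vanish because `v` tends to `0` and `v'` is bounded; no limit of `v'` at the
  -- ends is needed.
  have htend : ∀ a ∈ Set.Icc (0 : ℝ) 1, v a = 0 →
      Filter.Tendsto (fun x => v x * deriv v x * expWeight κ₁ κ₂ x)
        (nhdsWithin a (Set.Ioo 0 1)) (nhds 0) := by
    intro a ha hva
    have h1 : Filter.Tendsto (fun x => |v x| * D) (nhdsWithin a (Set.Ioo 0 1)) (nhds 0) := by
      have h2 := ((hv.continuousOn a ha).mono Set.Ioo_subset_Icc_self).abs.mul_const D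
      simpa [hva, ContinuousWithinAt] using h2
    refine squeeze_zero_norm' ?_ h1
    filter_upwards [self_mem_nhdsWithin] with x hx
    rw [norm_mul, norm_mul, Real.norm_of_nonneg (expWeight_pos ..).le]
    exact (mul_le_of_le_one_right (by positivity) (expWeight_le_one h₁ h₂ hx.1.le)).trans
      (mul_le_mul_of_nonneg_left (hD x hx) (abs_nonneg _))
  have hl := htend 0 (by simp) hv.left
  have hr := htend 1 (by simp) hv.right
  rw [nhdsWithin_Ioo_eq_nhdsGT zero_lt_one] at hl
  rw [nhdsWithin_Ioo_eq_nhdsLT zero_lt_one] at hr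
  rw [intervalIntegral.integral_eq_sub_of_hasDerivAt_of_tendsto zero_lt_one hderiv
    (hdd.add hvF) hl hr, sub_zero]

/-- Stability in the energy norm of `v - a v'' + a (κ₂/κ₁) v' = ∑ cᵢ gᵢ + r` with `|r| ≤ ρ`. -/
theorem IsClassicalProfile.energyNorm_le {ι : Type*} {κ₁ κ₂ a ρ : ℝ} {v : ℝ → ℝ}
    (hv : IsClassicalProfile v) (h₁ : 0 < κ₁) (h₂ : 0 ≤ κ₂) (ha : 0 < a)
    (s : Finset ι) (c A : ι → ℝ) (g : ι → ℝ → ℝ) (hc : ∀ i ∈ s, 0 ≤ c i)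
    (hg : ∀ i ∈ s, ContinuousOn (g i) (Set.Icc 0 1))
    (hA : ∀ i ∈ s, √(weightedInner (expWeight κ₁ κ₂) (g i) (g i)) ≤ A i)
    (hr : ∀ x ∈ Set.Ioo (0 : ℝ) 1,
      |v x - a * (deriv (deriv v) x - κ₂ / κ₁ * deriv v x) - ∑ i ∈ s, c i * g i x| ≤ ρ) :
    HasFiniteEnergy (expWeight κ₁ κ₂) v ∧
      energyNorm a (expWeight κ₁ κ₂) v ≤ ∑ i ∈ s, c i * A i + ρ := by
  set w := expWeight κ₁ κ₂ with hwdef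
  set h : ℝ → ℝ := fun x => ∑ i ∈ s, c i * g i x with hh
  set F : ℝ → ℝ := fun x => deriv (deriv v) x - κ₂ / κ₁ * deriv v x with hF
  have hw : Continuous w := continuous_expWeight κ₁ κ₂
  have hw0 : ∀ x, 0 ≤ w x := fun x => (expWeight_pos κ₁ κ₂ x).le
  have hhc : ContinuousOn h (Set.Icc 0 1) :=
    continuousOn_finsetSum _ fun i hi => continuousOn_const.mul (hg i hi)
  have hρ : 0 ≤ ρ := (abs_nonneg _).trans (hr (1 / 2) (by norm_num))
  obtain ⟨B, hB⟩ := isCompact_Icc.exists_bound_of_continuousOn (hv.continuousOn.sub hhc)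
  -- The equation itself bounds `F`, since `v` and `h` are continuous on a compact interval.
  have hFB : ∀ x ∈ Set.Ioo (0 : ℝ) 1, |F x| ≤ (B + ρ) / a := by
    intro x hx
    have b1 : |v x - h x| ≤ B := hB x ⟨hx.1.le, hx.2.le⟩
    have b2 : |v x - a * F x - h x| ≤ ρ := hr x hx
    rw [le_div_iff₀ ha, mul_comm]
    nth_rw 1 [← abs_of_pos ha]
    rw [← abs_mul]
    rw [abs_le] at *
    constructor <;> linarith
  obtain ⟨hfin, hvF, hid⟩ := hv.energy_identity h₁ h₂ hFB
  refine ⟨hfin, ?_⟩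
  set n := √(weightedInner w v v) with hn
  have hvabs : ContinuousOn (fun x => |v x|) (Set.Icc 0 1) := hv.continuousOn.abs
  have hone : √(weightedInner w (fun _ => 1) (fun _ => 1)) ≤ 1 := by
    refine Real.sqrt_le_one.2 ?_
    have : ∫ x in (0 : ℝ)..1, (1 : ℝ) * 1 * w x ≤ ∫ x in (0 : ℝ)..1, (1 : ℝ) :=
      intervalIntegral.integral_mono_on zero_le_one
        (intervalIntegrable_mul_weight hw continuousOn_const continuousOn_const)
        intervalIntegrable_const fun x hx => by
          simpa using expWeight_le_one h₁ h₂ hx.1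
    simpa [weightedInner] using this
  have habs : weightedInner w (fun x => |v x|) (fun _ => 1) ≤ n := by
    refine (weightedInner_le hw hw0 hvabs continuousOn_const).trans ?_
    have : weightedInner w (fun x => |v x|) (fun x => |v x|) = weightedInner w v v := by
      simp [weightedInner]
    rw [this]
    exact mul_le_of_le_one_right (Real.sqrt_nonneg _) hone
  have hvh : weightedInner w v h ≤ n * ∑ i ∈ s, c i * A i := by
    rw [weightedInner_sum hw hv.continuousOn s c g hg, Finset.mul_sum]
    refine Finset.sum_le_sum fun i hi => ?_
    rw [mul_left_comm]
    exact mul_le_mul_of_nonneg_left ((weightedInner_le hw hw0 hv.continuousOn (hg i hi)).trans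
      (mul_le_mul_of_nonneg_left (hA i hi) (Real.sqrt_nonneg _))) (hc i hi)
  -- The equation is tested against `v w`; the residual contributes at most `ρ |v| w`.
  have hle : weightedInner w v v - a * weightedInner w v F
      ≤ weightedInner w v h + ρ * weightedInner w (fun x => |v x|) (fun _ => 1) := by
    have ivv := intervalIntegrable_mul_weight hw hv.continuousOn hv.continuousOn
    have ivh := intervalIntegrable_mul_weight hw hv.continuousOn hhc
    have iv1 := (intervalIntegrable_mul_weight hw hvabs
      (continuousOn_const (c := (1 : ℝ)))).const_mul ρ
    simp only [weightedInner, ← intervalIntegral.integral_const_mul]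
    rw [← intervalIntegral.integral_sub ivv (hvF.const_mul a),
      ← intervalIntegral.integral_add ivh iv1]
    refine intervalIntegral.integral_mono_on_of_le_Ioo zero_le_one (ivv.sub (hvF.const_mul a))
      (ivh.add iv1) fun x hx => ?_
    have b2 : |v x - a * F x - h x| ≤ ρ := hr x hx
    have b3 : v x * (v x - a * F x - h x) ≤ |v x| * ρ :=
      (le_abs_self _).trans (by rw [abs_mul]; exact mul_le_mul_of_nonneg_left b2 (abs_nonneg _))
    have := mul_le_mul_of_nonneg_right b3 (hw0 x)
    linarith
  have hE : weightedInner w v v + a * weightedInner w (deriv v) (deriv v)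
      ≤ n * (∑ i ∈ s, c i * A i + ρ) := by
    have := mul_le_mul_of_nonneg_left habs hρ
    have hid' : weightedInner w (deriv v) (deriv v) = -weightedInner w v F := by linarith
    rw [hid']
    linarith
  have hR : 0 ≤ ∑ i ∈ s, c i * A i + ρ :=
    add_nonneg (Finset.sum_nonneg fun i hi =>
      mul_nonneg (hc i hi) ((Real.sqrt_nonneg _).trans (hA i hi))) hρ
  have hnE : n ≤ energyNorm a w v := sqrt_weightedInner_le_energyNorm ha.le hw0 v
  have hsq : energyNorm a w v * energyNorm a w v
      = weightedInner w v v + a * weightedInner w (deriv v) (deriv v) :=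
    Real.mul_self_sqrt (add_nonneg (weightedInner_self_nonneg hw0 _)
      (mul_nonneg ha.le (weightedInner_self_nonneg hw0 _)))
  -- The squared energy norm is at most `n` times the target and `n` is at most the energy norm, so
  -- one factor divides out.
  rcases (show 0 ≤ energyNorm a w v from Real.sqrt_nonneg _).eq_or_lt with h0 | h0
  · rw [← h0]; exact hR
  · refine le_of_mul_le_mul_left ?_ h0
    rw [hsq]
    exact hE.trans (mul_le_mul_of_nonneg_right hnE hR)

/-! ### The error equation -/

theorem IsClassicalProfile.sub {f g : ℝ → ℝ} (hf : IsClassicalProfile f)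
    (hg : IsClassicalProfile g) : IsClassicalProfile (fun x => f x - g x) where
  continuousOn := hf.continuousOn.sub hg.continuousOn
  differentiableAt x hx := (hf.differentiableAt x hx).sub (hg.differentiableAt x hx)
  differentiableAt_deriv x hx := by
    have he : deriv (fun x => f x - g x) =ᶠ[nhds x] fun x => deriv f x - deriv g x := by
      filter_upwards [isOpen_Ioo.mem_nhds hx] with y hy
      exact deriv_fun_sub (hf.differentiableAt y hy) (hg.differentiableAt y hy)
    exact ((hf.differentiableAt_deriv x hx).sub
      (hg.differentiableAt_deriv x hx)).congr_of_eventuallyEq he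
  left := by rw [hf.left, hg.left, sub_zero]
  right := by rw [hf.right, hg.right, sub_zero]

theorem IsClassicalProfile.deriv_sub {f g : ℝ → ℝ} (hf : IsClassicalProfile f)
    (hg : IsClassicalProfile g) {x : ℝ} (hx : x ∈ Set.Ioo (0 : ℝ) 1) :
    deriv (fun x => f x - g x) x = deriv f x - deriv g x :=
  deriv_fun_sub (hf.differentiableAt x hx) (hg.differentiableAt x hx)

theorem IsClassicalProfile.deriv_deriv_sub {f g : ℝ → ℝ} (hf : IsClassicalProfile f)
    (hg : IsClassicalProfile g) {x : ℝ} (hx : x ∈ Set.Ioo (0 : ℝ) 1) :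
    deriv (deriv (fun x => f x - g x)) x = deriv (deriv f) x - deriv (deriv g) x := by
  have he : deriv (fun x => f x - g x) =ᶠ[nhds x] fun x => deriv f x - deriv g x := by
    filter_upwards [isOpen_Ioo.mem_nhds hx] with y hy
    exact hf.deriv_sub hg hy
  rw [he.deriv_eq]
  exact deriv_fun_sub (hf.differentiableAt_deriv x hx) (hg.differentiableAt_deriv x hx)

/-- The first step and the later steps of the L1 scheme in a single formula. -/
theorem IsSemidiscreteSolution.step_eq {α κ₁ κ₂ τ : ℝ} {M : ℕ} {S : ℝ → ℝ → ℝ} {g : ℝ → ℝ}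
    {U : ℕ → ℝ → ℝ} (h : IsSemidiscreteSolution α κ₁ κ₂ τ M S g U) (h1 : α < 1) {n : ℕ}
    (hn : n < M) {x : ℝ} (hx : x ∈ Set.Ioo (0 : ℝ) 1) :
    U (n + 1) x - κ₁ * stepFactor α τ * deriv (deriv (U (n + 1))) x
        + κ₂ * stepFactor α τ * deriv (U (n + 1)) x
      = ∑ j ∈ Finset.range n, (l1Coeff α j - l1Coeff α (j + 1)) * U (n - j) x
        + l1Coeff α n * U 0 x + stepFactor α τ * S x ((n + 1 : ℕ) * τ) := by
  rcases n with _ | n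
  · have := h.first_step hn x hx
    simpa [l1Coeff_zero h1] using this
  · have := h.step (n + 1) (by omega) hn x hx
    have hI : Finset.Icc 1 (n + 1 - 1) = Finset.Ico 1 (n + 1) := by
      ext; simp only [Finset.mem_Icc, Finset.mem_Ico]; omega
    -- The separate coefficient `1 - b_1` is the `j = 0` term `b_0 - b_1`.
    rw [this, Finset.sum_range_succ', l1Coeff_zero h1, hI, Finset.sum_Ico_eq_sum_range,
      Nat.add_sub_cancel]
    simp only [Nat.cast_add, Nat.cast_one, add_comm, add_left_comm, one_add_one_eq_two, zero_add,
      Nat.add_sub_add_right, Nat.sub_zero]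
    ring_nf

/-- The error equation of the L1 scheme, with the truncation error as residual. -/
theorem IsSemidiscreteSolution.error_residual_le {α κ₁ κ₂ τ T K : ℝ} {M : ℕ} {S : ℝ → ℝ → ℝ}
    {g : ℝ → ℝ} {u : ℝ → ℝ → ℝ} {U : ℕ → ℝ → ℝ}
    (hU : IsSemidiscreteSolution α κ₁ κ₂ τ M S g U)
    (hu : IsExactSolution α κ₁ κ₂ T S g u) (h0 : 0 < α) (h1 : α < 1) (hκ : 0 < κ₁) (hτ : 0 < τ)
    (hMT : M * τ ≤ T) (hC : ∀ x ∈ Set.Ioo (0 : ℝ) 1, ContDiffOn ℝ 2 (u x) (Set.Icc 0 T))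
    (hK : ∀ x ∈ Set.Ioo (0 : ℝ) 1, ∀ t ∈ Set.Ioo (0 : ℝ) T, |iteratedDeriv 2 (u x) t| ≤ K)
    {e : ℕ → ℝ → ℝ} (he : ∀ n, e n = fun x => u x (n * τ) - U n x) {n : ℕ} (hn : n < M)
    {x : ℝ} (hx : x ∈ Set.Ioo (0 : ℝ) 1) :
    |e (n + 1) x - κ₁ * stepFactor α τ *
        (deriv (deriv (e (n + 1))) x - κ₂ / κ₁ * deriv (e (n + 1)) x)
      - ∑ j ∈ Finset.range n, (l1Coeff α j - l1Coeff α (j + 1)) * e (n - j) x|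
      ≤ 2 * K * τ ^ 2 := by
  have hle : ((n + 1 : ℕ) : ℝ) * τ ≤ T :=
    (mul_le_mul_of_nonneg_right (by exact_mod_cast hn) hτ.le).trans hMT
  have hmem : ((n + 1 : ℕ) : ℝ) * τ ∈ Set.Ioc 0 T := ⟨by positivity, hle⟩
  have hpu := hu.profile _ hmem
  have hpU := hU.profile (n + 1) (by omega) hn
  have htr := l1_truncation_error h0 h1 hτ n.succ_pos hle (hC x hx) (hK x hx)
  rw [sum_mul_backward_diff (l1Coeff_zero h1) (fun m : ℕ => u x (m * τ)) n,
    hu.equation x hx _ hmem] at htr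
  have hstep := hU.step_eq h1 hn hx
  have hx' : x ∈ Set.Icc (0 : ℝ) 1 := ⟨hx.1.le, hx.2.le⟩
  -- Both start from `g`, so the `b_n` terms cancel in the error.
  have hinit : u x ((0 : ℕ) * τ) = U 0 x := by
    rw [Nat.cast_zero, zero_mul, hu.initial x hx', hU.initial x hx']
  have hsum : ∑ j ∈ Finset.range n, (l1Coeff α j - l1Coeff α (j + 1)) * e (n - j) x
      = ∑ j ∈ Finset.range n, (l1Coeff α j - l1Coeff α (j + 1)) * u x ((n - j : ℕ) * τ)
        - ∑ j ∈ Finset.range n, (l1Coeff α j - l1Coeff α (j + 1)) * U (n - j) x := by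
    rw [← Finset.sum_sub_distrib]
    exact Finset.sum_congr rfl fun j _ => by rw [he, mul_sub]
  rw [hsum, he (n + 1), hpu.deriv_deriv_sub hpU hx, hpu.deriv_sub hpU hx, ← abs_neg]
  refine le_of_eq_of_le ?_ htr
  congr 1
  rw [hinit]
  field_simp
  linear_combination hstep

/-! ### The error bounds -/

theorem mainTheorem4 :
    ∃ C : ℝ, 0 < C ∧
      ∀ (α κ₁ κ₂ T : ℝ) (S : ℝ → ℝ → ℝ) (g : ℝ → ℝ) (u : ℝ → ℝ → ℝ) (K : ℝ),
        0 < α → α < 1 → 0 < κ₁ → 0 ≤ κ₂ → 0 < T →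
        IsExactSolution α κ₁ κ₂ T S g u →
        (∀ x ∈ Set.Ioo (0 : ℝ) 1, ContDiffOn ℝ 2 (u x) (Set.Icc 0 T)) →
        (∀ x ∈ Set.Ioo (0 : ℝ) 1, ∀ t ∈ Set.Ioo (0 : ℝ) T, |iteratedDeriv 2 (u x) t| ≤ K) →
        ∀ (M : ℕ) (U : ℕ → ℝ → ℝ),
          IsSemidiscreteSolution α κ₁ κ₂ (T / M) M S g U →
          ∀ k : ℕ, 1 ≤ k → k ≤ M →
            HasFiniteEnergy (expWeight κ₁ κ₂) (fun x => u x (k * (T / M)) - U k x) ∧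
            energyNorm (κ₁ * stepFactor α (T / M)) (expWeight κ₁ κ₂)
                (fun x => u x (k * (T / M)) - U k x)
              ≤ C * K / (1 - α) * T ^ α * (T / M) ^ (2 - α) ∧
            energyNorm (κ₁ * stepFactor α (T / M)) (expWeight κ₁ κ₂)
                (fun x => u x (k * (T / M)) - U k x)
              ≤ C * K * T * (T / M) := by
  -- The constant counts one `Kτ²` for the singular cell and one for all the others.
  refine ⟨2, two_pos, ?_⟩
  intro α κ₁ κ₂ T S g u K h0 h1 hκ₁ hκ₂ hT hu hC hK M U hU k hk hkM
  have hM : (0 : ℝ) < M := by exact_mod_cast hk.trans hkM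
  have hα : 0 < 1 - α := by linarith
  set τ := T / M with hτdef
  have hτ : 0 < τ := div_pos hT hM
  have hMτ : M * τ = T := by rw [hτdef]; field_simp
  have hK0 : 0 ≤ K := (abs_nonneg _).trans
    (hK (1 / 2) (by norm_num) (T / 2) ⟨by linarith, by linarith⟩)
  set w := expWeight κ₁ κ₂ with hw
  set a := κ₁ * stepFactor α τ with ha_def
  have ha : 0 < a := mul_pos hκ₁ (mul_pos (Real.rpow_pos_of_pos hτ _)
    (Real.Gamma_pos_of_pos (by linarith)))
  set e : ℕ → ℝ → ℝ := fun n x => u x (n * τ) - U n x with he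
  have hprof : ∀ n, 1 ≤ n → n ≤ M → IsClassicalProfile (e n) := fun n hn hnM =>
    (hu.profile (n * τ) ⟨by positivity, by
      rw [← hMτ]; exact mul_le_mul_of_nonneg_right (by exact_mod_cast hnM) hτ.le⟩).sub
      (hU.profile n hn hnM)
  have hρ : 0 ≤ 2 * K * τ ^ 2 := by positivity
  have henergy : ∀ n < M, HasFiniteEnergy w (e (n + 1)) ∧ energyNorm a w (e (n + 1)) ≤
      ∑ j ∈ Finset.range n, (l1Coeff α j - l1Coeff α (j + 1)) * energyNorm a w (e (n - j))
        + 2 * K * τ ^ 2 := by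
    intro n hn
    refine (hprof (n + 1) (by omega) hn).energyNorm_le hκ₁ hκ₂ ha (Finset.range n) _
      (fun j => energyNorm a w (e (n - j))) (fun j => e (n - j))
      (fun j _ => sub_nonneg.2 (l1Coeff_antitone h0 h1 j.le_succ)) (fun j hj => ?_)
      (fun j _ => sqrt_weightedInner_le_energyNorm ha.le (fun x => (expWeight_pos κ₁ κ₂ x).le) _)
      (fun x hx => hU.error_residual_le hu h0 h1 hκ₁ hτ hMτ.le hC hK (fun _ => rfl) hn hx)
    have := Finset.mem_range.1 hj
    exact (hprof (n - j) (by omega) (by omega)).continuousOn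
  -- The recursion only involves indices `n - j ≥ 1`, so the value at `0` can be set to `0`, as the
  -- linear Gronwall bound requires.
  set A : ℕ → ℝ := fun n => if n = 0 then 0 else energyNorm a w (e n) with hA
  have hrec : ∀ n < M, A (n + 1) ≤
      ∑ j ∈ Finset.range n, (l1Coeff α j - l1Coeff α (j + 1)) * A (n - j) + 2 * K * τ ^ 2 := by
    intro n hn
    have hs : ∑ j ∈ Finset.range n, (l1Coeff α j - l1Coeff α (j + 1)) * A (n - j)
        = ∑ j ∈ Finset.range n,
          (l1Coeff α j - l1Coeff α (j + 1)) * energyNorm a w (e (n - j)) := by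
      refine Finset.sum_congr rfl fun j hj => ?_
      have := Finset.mem_range.1 hj
      simp only [hA, if_neg (show n - j ≠ 0 by omega)]
    rw [hs]
    simpa only [hA, if_neg n.succ_ne_zero] using (henergy n hn).2
  have hlin := convolution_gronwall_linear (l1Coeff_zero h1) (l1Coeff_antitone h0 h1)
    (l1Coeff_pos h0 h1) hρ (by simp [hA]) hrec k hkM
  have hinv := convolution_gronwall_inv (l1Coeff_zero h1) (l1Coeff_antitone h0 h1)
    (l1Coeff_pos h0 h1) hρ hrec
  obtain ⟨n, rfl⟩ : ∃ n, k = n + 1 := ⟨k - 1, by omega⟩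
  have hkT : ((n + 1 : ℕ) : ℝ) * τ ≤ T := by
    rw [← hMτ]; exact mul_le_mul_of_nonneg_right (by exact_mod_cast hkM) hτ.le
  refine ⟨(henergy n hkM).1, ?_, ?_⟩
  · have h2 : energyNorm a w (e (n + 1)) ≤ 2 * K * τ ^ 2 / l1Coeff α n := by
      simpa only [hA, if_neg n.succ_ne_zero] using hinv n hkM
    refine h2.trans ?_
    have hn : (0 : ℝ) < (n : ℝ) + 1 := by positivity
    have hna : 0 < ((n : ℝ) + 1) ^ (-α) := Real.rpow_pos_of_pos hn _
    have hkα : (((n : ℝ) + 1) * τ) ^ α ≤ T ^ α :=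
      Real.rpow_le_rpow (by positivity) (by exact_mod_cast hkT) h0.le
    -- The factor `τ ^ α` joins `(n + 1) ^ α` to form `t_{n+1} ^ α ≤ T ^ α`.
    have hpow : τ ^ 2 = τ ^ α * τ ^ (2 - α) := by
      rw [← Real.rpow_add hτ, ← Real.rpow_natCast]; norm_num
    calc 2 * K * τ ^ 2 / l1Coeff α n
        ≤ 2 * K * τ ^ 2 / ((1 - α) * ((n : ℝ) + 1) ^ (-α)) :=
          div_le_div_of_nonneg_left hρ (by positivity) (l1Coeff_lower h0 h1 n)
      _ = 2 * K / (1 - α) * (((n : ℝ) + 1) * τ) ^ α * τ ^ (2 - α) := by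
          rw [Real.rpow_neg hn.le, Real.mul_rpow hn.le hτ.le, hpow]
          field_simp
      _ ≤ 2 * K / (1 - α) * T ^ α * τ ^ (2 - α) := by gcongr
  · have h2 : energyNorm a w (e (n + 1)) ≤ (n + 1 : ℕ) * (2 * K * τ ^ 2) := by
      simpa only [hA, if_neg n.succ_ne_zero] using hlin
    refine h2.trans ?_
    have := mul_le_mul_of_nonneg_left hkT (show 0 ≤ 2 * K * τ by positivity)
    linarith
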